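/- For integers $n \ge 2k \ge 2$, the Schrijver graph $\operatorname{SG}(n,k)$ has as vertices the $k$-subsets of $\{1,\dots,n\}$ that contain no two consecutive elements (where $1$ and $n$ are also considered consecutive); two vertices are adjacent if and only if they are disjoint. Let $D(G)$ denote the diameter of a connected graph $G$, i.e. the maximum distance between two of its vertices. Let $n = 2k+r$ with $2 \le r \le k-3$. Then $\operatorname{SG}(n,k)$ is connected and $D(\operatorname{SG}(n,k)) \ge 4$. More precisely, with $t = k-3-r$, the sets $$A^n_k=\{1,3,5\}\cup\{7+2i : 0\le i\le t\}\cup\{7+2t+3j : 1\le j\le r-1\},$$ $$B^n_k=\{1,3,6\}\cup\{8+2i : 0\le i\le t\}\cup\{8+2t+3j : 1\le j\le r-1\}$$ are vertices of $\operatorname{SG}(n,k)$ at distance at least $4$. In particular, $D(\operatorname{SG}(3k-3,k)) = 4$ for every $k \ge 5$. -/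

import Mathlib

/-- `S` is a 2-stable subset of `{1, …, n}`: it contains no two elements that are consecutive on
the `n`-cycle, where `1` and `n` count as consecutive. -/
def IsTwoStable (n : ℕ) (S : Finset ℕ) : Prop :=
  S ⊆ Finset.Icc 1 n ∧ ∀ i ∈ S, ∀ j ∈ S, i < j → i + 2 ≤ j ∧ j + 2 ≤ i + n

/-- The 2-stable `k`-subsets of `{1, …, n}`. -/
def SchrijverVertex (n k : ℕ) : Type :=
  {S : Finset ℕ // IsTwoStable n S ∧ S.card = k}

/-- The Schrijver graph `SG(n, k)`: the subgraph of the Kneser graph `KG(n, k)` induced on the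
2-stable `k`-subsets of `{1, …, n}`; two (distinct) vertices are adjacent when they are disjoint. -/
def schrijverGraph (n k : ℕ) : SimpleGraph (SchrijverVertex n k) where
  Adj S T := S ≠ T ∧ Disjoint S.1 T.1
  symm := ⟨fun _ _ h => ⟨h.1.symm, h.2.symm⟩⟩
  loopless := ⟨fun _ h => h.1 rfl⟩

/-- With `n = 2k + r`, `2 ≤ r ≤ k - 3` and `t = k - 3 - r`, the set
`{1, 3, 5} ∪ {7 + 2i : 0 ≤ i ≤ t} ∪ {7 + 2t + 3j : 1 ≤ j ≤ r - 1}`. -/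
def witnessA (k r : ℕ) : Finset ℕ :=
  let t := k - 3 - r
  {1, 3, 5} ∪ (Finset.Icc 0 t).image (fun i => 7 + 2 * i) ∪
    (Finset.Icc 1 (r - 1)).image (fun j => 7 + 2 * t + 3 * j)

/-- With `n = 2k + r`, `2 ≤ r ≤ k - 3` and `t = k - 3 - r`, the set
`{1, 3, 6} ∪ {8 + 2i : 0 ≤ i ≤ t} ∪ {8 + 2t + 3j : 1 ≤ j ≤ r - 1}`. -/
def witnessB (k r : ℕ) : Finset ℕ :=
  let t := k - 3 - r
  {1, 3, 6} ∪ (Finset.Icc 0 t).image (fun i => 8 + 2 * i) ∪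
    (Finset.Icc 1 (r - 1)).image (fun j => 8 + 2 * t + 3 * j)

/-! Lower bound: both witnesses have cyclic gaps 2 and 3 only. A neighbour of such a set has exactly
one element in each gap, hence contains the midpoint of every gap of length 2
(`IsTwoStable.mem_of_disjoint`). So neighbours of `A` contain 2 and 6, and neighbours of `B` contain
2. As 6 lies in `B`, there is no walk of length two; in a walk of length three the two inner
vertices would share 2.

Upper bound for `n = 3k - 3`: sliding each element forward by one or two places gives neighbours. If
`A` and `B` have no common pair `c, c + 2`, they slide to disjoint sets, a walk of length three.
Otherwise `hubSet k c` has a common neighbour with each of them (`hubSet_gap`), a walk of length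
four.

Connectedness: lowering one element by one is a walk of length two, and repeating this packs any
vertex into `{0, 2, …, 2(k - 1)}`. -/

/-! ### Neighbours obtained by sliding -/

/-- A set of residues modulo `n` without two cyclically consecutive elements. -/
def CyclicStable {n : ℕ} (S : Finset (ZMod n)) : Prop :=
  ∀ x ∈ S, x + 1 ∉ S

/-- Each element `a` of `A` is moved by two steps if `p a` holds, and by one step otherwise. -/
def shiftSet {n : ℕ} (A : Finset (ZMod n)) (p : ZMod n → Prop) [DecidablePred p] :
    Finset (ZMod n) :=
  A.image fun a => if p a then a + 2 else a + 1

/-- Cyclic gaps are at least 2, and at least 3 after an element that moves by two, so every element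
lands strictly inside its own gap and stays at least two places behind the image of the next one. -/
theorem CyclicStable.shiftSet {n : ℕ} {A : Finset (ZMod n)} (hA : CyclicStable A)
    (p : ZMod n → Prop) [DecidablePred p] (h : ∀ a ∈ A, p a → a + 2 ∉ A) :
    CyclicStable (shiftSet A p) ∧ (shiftSet A p).card = A.card ∧ Disjoint A (shiftSet A p) := by
  refine ⟨?_, ?_, ?_⟩
  · intro x hx hx'
    simp only [_root_.shiftSet, Finset.mem_image] at hx hx'
    obtain ⟨a, ha, rfl⟩ := hx
    obtain ⟨b, hb, hab⟩ := hx'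
    split_ifs at hab with h1 h2 h2
    · exact hA a ha (by convert hb using 1; linear_combination -hab)
    · obtain rfl : b = a := by linear_combination hab
      exact h2 h1
    · exact h a ha h2 (by convert hb using 1; linear_combination -hab)
    · exact hA a ha (by convert hb using 1; linear_combination -hab)
  · refine Finset.card_image_of_injOn fun a ha b hb hab => ?_
    replace hab : (if p a then a + 2 else a + 1) = if p b then b + 2 else b + 1 := hab
    split_ifs at hab with h1 h2 h2
    · linear_combination hab
    · have hb' : b ∈ A := hb
      exact absurd (show a + 1 ∈ A by convert hb' using 1; linear_combination hab) (hA a ha)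
    · have ha' : a ∈ A := ha
      exact absurd (show b + 1 ∈ A by convert ha' using 1; linear_combination -hab) (hA b hb)
    · linear_combination hab
  · rw [Finset.disjoint_right]
    intro x hx
    obtain ⟨a, ha, rfl⟩ := Finset.mem_image.1 hx
    split_ifs with h1
    · exact h a ha h1
    · exact hA a ha

/-- Two stable sets `A`, `E` such that no element of `A` is the only point between two elements of
`E` are disjoint from a common stable set of the size of `E`. -/
theorem CyclicStable.exists_common_neighbor {n : ℕ} {A E : Finset (ZMod n)}
    (hA : CyclicStable A) (hE : CyclicStable E) (h : ∀ x ∈ E, x + 1 ∈ A → x + 2 ∉ E) :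
    ∃ C : Finset (ZMod n), CyclicStable C ∧ C.card = E.card ∧ Disjoint A C ∧ Disjoint C E := by
  classical
  -- An element moves by two only when `A` blocks its next place; the place after that is then free
  -- by stability of `A`.
  obtain ⟨h1, h2, h3⟩ := hE.shiftSet (fun e => e + 1 ∈ A) h
  refine ⟨_, h1, h2, ?_, h3.symm⟩
  rw [Finset.disjoint_right]
  intro x hx
  obtain ⟨a, ha, rfl⟩ := Finset.mem_image.1 hx
  split_ifs with h1
  · have := hA _ h1
    rwa [add_assoc, one_add_one_eq_two] at this
  · exact h1

/-- If no point lies between two elements of `A` and also between two elements of `B`, then `A` and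
`B` are joined by a walk of length three. -/
theorem CyclicStable.exists_disjoint_neighbors {n : ℕ} {A B : Finset (ZMod n)}
    (hA : CyclicStable A) (hB : CyclicStable B)
    (h : ∀ x ∈ A, x ∈ B → x + 2 ∈ A → x + 2 ∉ B) :
    ∃ C D : Finset (ZMod n), (CyclicStable C ∧ C.card = A.card) ∧
      (CyclicStable D ∧ D.card = B.card) ∧ Disjoint A C ∧ Disjoint C D ∧ Disjoint D B := by
  classical
  -- At each common point exactly one of the two copies moves by two: that of `A` if `B` has an
  -- element two places on, that of `B` otherwise. All other points move by one.
  obtain ⟨hC, hCc, hAC⟩ := hA.shiftSet (fun a => a ∈ B ∧ a + 2 ∈ B)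
    fun a ha hp ha2 => h a ha hp.1 ha2 hp.2
  obtain ⟨hD, hDc, hBD⟩ := hB.shiftSet (fun b => b ∈ A ∧ b + 2 ∉ B) fun b _ hp => hp.2
  refine ⟨_, _, ⟨hC, hCc⟩, ⟨hD, hDc⟩, hAC, ?_, hBD.symm⟩
  rw [Finset.disjoint_left]
  intro x hx hx'
  simp only [_root_.shiftSet, Finset.mem_image] at hx hx'
  obtain ⟨a, ha, rfl⟩ := hx
  obtain ⟨b, hb, hab⟩ := hx'
  split_ifs at hab with h1 h2 h2
  · obtain rfl : b = a := by linear_combination hab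
    exact h1.2 h2.2
  · exact hA b h1.1 (by convert ha using 1; linear_combination hab)
  · exact hB a h2.1 (by convert hb using 1; linear_combination -hab)
  · obtain rfl : b = a := by linear_combination hab
    exact h2 ⟨hb, by_contra fun h3 => h1 ⟨ha, h3⟩⟩

/-! ### The hub modulo `3k - 3` -/

theorem ZMod.val_add_one_eq_ite {n : ℕ} (hn : 2 ≤ n) (w : ZMod n) :
    (w + 1).val = if w.val + 1 = n then 0 else w.val + 1 := by
  have : NeZero n := ⟨by omega⟩
  have : Fact (1 < n) := ⟨hn⟩
  have hw := w.val_lt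
  rw [ZMod.val_add, ZMod.val_one]
  split_ifs with h
  · rw [h, Nat.mod_self]
  · exact Nat.mod_eq_of_lt (by omega)

/-- The set `{c, c + 2} ∪ {c + 4 + 3 * i : i < k - 2}` modulo `3 * k - 3`. -/
def hubSet (k : ℕ) (c : ZMod (3 * k - 3)) : Finset (ZMod (3 * k - 3)) :=
  ({0, 2} ∪ (Finset.range (k - 2)).image fun i => 4 + 3 * i).image
    fun v : ℕ => c + (v : ZMod (3 * k - 3))

theorem mem_hubSet {k : ℕ} (hk : 4 ≤ k) {c z : ZMod (3 * k - 3)} :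
    z ∈ hubSet k c ↔ (z - c).val = 0 ∨ (z - c).val = 2 ∨
      4 ≤ (z - c).val ∧ (z - c).val % 3 = 1 := by
  have : NeZero (3 * k - 3) := ⟨by omega⟩
  simp only [hubSet, Finset.mem_image, Finset.mem_union, Finset.mem_insert, Finset.mem_singleton,
    Finset.mem_range]
  constructor
  · rintro ⟨v, hv, rfl⟩
    have hlt : v < 3 * k - 3 := by
      rcases hv with (rfl | rfl) | ⟨i, hi, rfl⟩ <;> omega
    rw [add_sub_cancel_left, ZMod.val_natCast_of_lt hlt]
    rcases hv with (rfl | rfl) | ⟨i, hi, rfl⟩ <;> omega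
  · intro h
    have hlt := (z - c).val_lt
    refine ⟨(z - c).val, ?_, by rw [ZMod.natCast_zmod_val]; ring⟩
    rcases h with h | h | ⟨h, h'⟩
    · exact Or.inl (Or.inl h)
    · exact Or.inl (Or.inr h)
    · exact Or.inr ⟨((z - c).val - 4) / 3, by omega, by omega⟩

theorem hubSet_card {k : ℕ} (hk : 4 ≤ k) (c : ZMod (3 * k - 3)) : (hubSet k c).card = k := by
  have : NeZero (3 * k - 3) := ⟨by omega⟩
  rw [hubSet, Finset.card_image_of_injOn, Finset.card_union_of_disjoint,
    Finset.card_image_of_injective, Finset.card_range, Finset.card_pair (by norm_num)]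
  · omega
  · intro i j hij
    simp only at hij
    omega
  · rw [Finset.disjoint_right]
    intro x hx
    obtain ⟨i, -, rfl⟩ := Finset.mem_image.1 hx
    simp only [Finset.mem_insert, Finset.mem_singleton]
    omega
  · have hlt : ∀ v ∈ ({0, 2} ∪ (Finset.range (k - 2)).image fun i => 4 + 3 * i : Finset ℕ),
        v < 3 * k - 3 := by
      intro v hv
      simp only [Finset.mem_image, Finset.mem_union, Finset.mem_insert, Finset.mem_singleton,
        Finset.mem_range] at hv
      rcases hv with (rfl | rfl) | ⟨i, hi, rfl⟩ <;> omega
    intro v hv w hw hvw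
    have := congrArg ZMod.val (add_left_cancel hvw)
    rwa [ZMod.val_natCast_of_lt (hlt v hv), ZMod.val_natCast_of_lt (hlt w hw)] at this

theorem hubSet_stable {k : ℕ} (hk : 4 ≤ k) (c : ZMod (3 * k - 3)) : CyclicStable (hubSet k c) := by
  have : NeZero (3 * k - 3) := ⟨by omega⟩
  intro x hx hx'
  rw [mem_hubSet hk] at hx hx'
  have h1 := ZMod.val_add_one_eq_ite (by omega) (x - c)
  have hlt := (x - c).val_lt
  rw [show x + 1 - c = x - c + 1 by ring] at hx'
  split_ifs at h1 <;> omega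

/-- A stable set containing `c` and `c + 2` avoids every point between two elements of the hub. -/
theorem hubSet_gap {k : ℕ} (hk : 4 ≤ k) {c : ZMod (3 * k - 3)} {A : Finset (ZMod (3 * k - 3))}
    (hA : CyclicStable A) (h0 : c ∈ A) (h2 : c + 2 ∈ A) :
    ∀ x ∈ hubSet k c, x + 1 ∈ A → x + 2 ∉ hubSet k c := by
  have : NeZero (3 * k - 3) := ⟨by omega⟩
  intro x hx hxA hx'
  rw [mem_hubSet hk] at hx hx'
  have h1 := ZMod.val_add_one_eq_ite (by omega) (x - c)
  have h3 := ZMod.val_add_one_eq_ite (by omega) (x - c + 1)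
  have hlt := (x - c).val_lt
  rw [show x + 2 - c = x - c + 1 + 1 by ring] at hx'
  -- The gaps of length 2 in the hub start at `c`, `c + 2` and `c - 2`; their midpoints are all
  -- adjacent to `c` or `c + 2`.
  have key : (x - c).val = 0 ∨ (x - c).val = 2 ∨ (x - c + 1 + 1).val = 0 := by
    split_ifs at h1 h3 <;> omega
  have val0 : ∀ v, (x - c).val = v → x = c + (v : ZMod (3 * k - 3)) := by
    rintro v rfl
    rw [ZMod.natCast_zmod_val]
    ring
  rcases key with h | h | h
  · have hx0 := val0 0 h
    refine hA c h0 ?_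
    rwa [hx0, Nat.cast_zero, add_zero] at hxA
  · have hx0 := val0 2 h
    refine hA _ h2 ?_
    rwa [hx0, Nat.cast_ofNat] at hxA
  · rw [ZMod.val_eq_zero] at h
    refine hA _ hxA ?_
    convert h0 using 1
    linear_combination h

/-- Any two stable `k`-subsets of `ZMod (3 * k - 3)` are joined by a walk of length three or
four. -/
theorem CyclicStable.exists_walk {k : ℕ} (hk : 4 ≤ k) {A B : Finset (ZMod (3 * k - 3))}
    (hA : CyclicStable A) (hB : CyclicStable B) (hAk : A.card = k) (hBk : B.card = k) :
    (∃ C D : Finset (ZMod (3 * k - 3)), (CyclicStable C ∧ C.card = k) ∧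
      (CyclicStable D ∧ D.card = k) ∧ Disjoint A C ∧ Disjoint C D ∧ Disjoint D B) ∨
    ∃ C E D : Finset (ZMod (3 * k - 3)), (CyclicStable C ∧ C.card = k) ∧
      (CyclicStable E ∧ E.card = k) ∧ (CyclicStable D ∧ D.card = k) ∧
      Disjoint A C ∧ Disjoint C E ∧ Disjoint E D ∧ Disjoint D B := by
  by_cases h : ∀ x ∈ A, x ∈ B → x + 2 ∈ A → x + 2 ∉ B
  · left
    have := hA.exists_disjoint_neighbors hB h
    rwa [hAk, hBk] at this
  · right
    push Not at h
    obtain ⟨c, hcA, hcB, hcA2, hcB2⟩ := h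
    have hE := hubSet_stable hk c
    have hEk := hubSet_card hk c
    obtain ⟨C, hC, hCk, hAC, hCE⟩ :=
      hA.exists_common_neighbor hE (hubSet_gap hk hA hcA hcA2)
    obtain ⟨D, hD, hDk, hBD, hDE⟩ :=
      hB.exists_common_neighbor hE (hubSet_gap hk hB hcB hcB2)
    exact ⟨C, _, D, ⟨hC, hCk.trans hEk⟩, ⟨hE, hEk⟩, ⟨hD, hDk.trans hEk⟩, hAC, hCE, hDE.symm,
      hBD.symm⟩

/-! ### From residues to vertices -/

theorem CyclicStable.isTwoStable_image {n : ℕ} (hn : 2 ≤ n) {T : Finset (ZMod n)}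
    (hT : CyclicStable T) : IsTwoStable n (T.image fun z => z.val + 1) := by
  have : NeZero n := ⟨by omega⟩
  refine ⟨?_, ?_⟩
  · intro i hi
    obtain ⟨z, -, rfl⟩ := Finset.mem_image.1 hi
    have := z.val_lt
    simp only [Finset.mem_Icc]
    omega
  · intro i hi j hj hij
    obtain ⟨x, hx, rfl⟩ := Finset.mem_image.1 hi
    obtain ⟨y, hy, rfl⟩ := Finset.mem_image.1 hj
    have hxn := x.val_lt
    have hyn := y.val_lt
    have hx1 := ZMod.val_add_one_eq_ite hn x
    have hy1 := ZMod.val_add_one_eq_ite hn y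
    have hxy : (x + 1).val ≠ y.val := fun h => hT x hx (ZMod.val_injective n h ▸ hy)
    have hyx : (y + 1).val ≠ x.val := fun h => hT y hy (ZMod.val_injective n h ▸ hx)
    split_ifs at hx1 hy1 <;> omega

/-- The vertex of the Schrijver graph given by a stable set of residues, where the residue `z`
stands for `z + 1`. -/
def CyclicStable.toVertex {n k : ℕ} (hn : 2 ≤ n) {T : Finset (ZMod n)}
    (hT : CyclicStable T ∧ T.card = k) : SchrijverVertex n k :=
  ⟨T.image fun z => z.val + 1, hT.1.isTwoStable_image hn, by
    have : NeZero n := ⟨by omega⟩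
    rw [Finset.card_image_of_injective, hT.2]
    exact fun x y h => ZMod.val_injective n (Nat.succ_injective h)⟩

theorem CyclicStable.adj_toVertex {n k : ℕ} (hn : 2 ≤ n) (hk : 0 < k) {S T : Finset (ZMod n)}
    (hS : CyclicStable S ∧ S.card = k) (hT : CyclicStable T ∧ T.card = k) (h : Disjoint S T) :
    (schrijverGraph n k).Adj (toVertex hn hS) (toVertex hn hT) := by
  have : NeZero n := ⟨by omega⟩
  have hd : Disjoint (toVertex hn hS).1 (toVertex hn hT).1 := by
    rw [toVertex, toVertex, Finset.disjoint_image]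
    · exact h
    · exact fun x y h => ZMod.val_injective n (Nat.succ_injective h)
  refine ⟨fun he => ?_, hd⟩
  rw [he, disjoint_self] at hd
  have := (toVertex hn hT).2.2
  rw [hd, Finset.bot_eq_empty, Finset.card_empty] at this
  omega

theorem SchrijverVertex.exists_toVertex_eq {n k : ℕ} (hn : 2 ≤ n) (v : SchrijverVertex n k) :
    ∃ (T : Finset (ZMod n)) (hT : CyclicStable T ∧ T.card = k),
      CyclicStable.toVertex hn hT = v := by
  have : NeZero n := ⟨by omega⟩
  obtain ⟨S, ⟨hS, hst⟩, hk⟩ := v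
  have himg : ((Finset.univ : Finset (ZMod n)).filter fun z => z.val + 1 ∈ S).image
      (fun z => z.val + 1) = S := by
    ext i
    simp only [Finset.mem_image, Finset.mem_filter, Finset.mem_univ, true_and]
    constructor
    · rintro ⟨z, hz, rfl⟩
      exact hz
    · intro hi
      have := Finset.mem_Icc.1 (hS hi)
      have hv : ((i - 1 : ℕ) : ZMod n).val + 1 = i := by
        rw [ZMod.val_natCast_of_lt (by omega)]
        omega
      exact ⟨_, hv.symm ▸ hi, hv⟩
  refine ⟨(Finset.univ : Finset (ZMod n)).filter fun z => z.val + 1 ∈ S, ⟨?_, ?_⟩,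
    Subtype.ext himg⟩
  · intro x hx hx1
    simp only [Finset.mem_filter, Finset.mem_univ, true_and] at hx hx1
    have h1 := ZMod.val_add_one_eq_ite hn x
    have hlt := x.val_lt
    split_ifs at h1 with h
    · have := hst _ hx1 _ hx (by omega)
      omega
    · have := hst _ hx _ hx1 (by omega)
      omega
  · rw [← hk, ← Finset.card_image_of_injective _
      (fun x y h => ZMod.val_injective n (Nat.succ_injective h) :
        Function.Injective fun z : ZMod n => z.val + 1), himg]

theorem exists_walk_length_le_four {k : ℕ} (hk : 4 ≤ k) (u v : SchrijverVertex (3 * k - 3) k) :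
    ∃ p : (schrijverGraph (3 * k - 3) k).Walk u v, p.length ≤ 4 := by
  have hn : 2 ≤ 3 * k - 3 := by omega
  have hk0 : 0 < k := by omega
  obtain ⟨A, hA, rfl⟩ := u.exists_toVertex_eq hn
  obtain ⟨B, hB, rfl⟩ := v.exists_toVertex_eq hn
  rcases CyclicStable.exists_walk hk hA.1 hB.1 hA.2 hB.2 with
    ⟨C, D, hC, hD, hAC, hCD, hDB⟩ | ⟨C, E, D, hC, hE, hD, hAC, hCE, hED, hDB⟩
  · exact ⟨.cons (CyclicStable.adj_toVertex hn hk0 hA hC hAC)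
      (.cons (CyclicStable.adj_toVertex hn hk0 hC hD hCD)
      (.cons (CyclicStable.adj_toVertex hn hk0 hD hB hDB) .nil)), by simp⟩
  · exact ⟨.cons (CyclicStable.adj_toVertex hn hk0 hA hC hAC)
      (.cons (CyclicStable.adj_toVertex hn hk0 hC hE hCE)
      (.cons (CyclicStable.adj_toVertex hn hk0 hE hD hED)
      (.cons (CyclicStable.adj_toVertex hn hk0 hD hB hDB) .nil))), by simp⟩

/-! ### Connectedness -/

/-- A stable set in which every nonzero `a` comes with `a - 2` is `{0, 2, …, 2 * (k - 1)}`. -/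
theorem Finset.eq_image_two_mul {n k : ℕ} (hn : 2 * k < n) {T : Finset (ZMod n)}
    (hT : T.card = k) (h : ∀ a ∈ T, a ≠ 0 → a - 2 ∈ T) :
    T = (Finset.range k).image fun i : ℕ => 2 * (i : ZMod n) := by
  have : NeZero n := ⟨by omega⟩
  refine Finset.eq_of_subset_of_card_le (fun a ha => ?_) ?_
  · by_contra hna
    -- Descending from a bad `a` in steps of 2 never meets 0, giving `k + 1` elements of `T`,
    -- distinct because `2k < n`.
    have hmem : ∀ i ≤ k, a - 2 * (i : ZMod n) ∈ T := by
      intro i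
      induction i with
      | zero => simpa using ha
      | succ i ih =>
        intro hi
        convert h _ (ih (by omega)) ?_ using 1
        · push_cast
          ring
        · intro h0
          exact hna (Finset.mem_image.2
            ⟨i, Finset.mem_range.2 (by omega), (sub_eq_zero.1 h0).symm⟩)
    have hcard : ((Finset.range (k + 1)).image fun i : ℕ => a - 2 * (i : ZMod n)).card = k + 1 := by
      rw [Finset.card_image_of_injOn, Finset.card_range]
      intro i hi j hj hij
      simp only [Finset.coe_range, Set.mem_Iio] at hi hj
      have h2 : ((2 * i : ℕ) : ZMod n) = ((2 * j : ℕ) : ZMod n) := by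
        push_cast
        exact sub_right_injective hij
      have h3 := congrArg ZMod.val h2
      rw [ZMod.val_natCast_of_lt (by omega), ZMod.val_natCast_of_lt (by omega)] at h3
      omega
    have hle := Finset.card_le_card (show
      ((Finset.range (k + 1)).image fun i : ℕ => a - 2 * (i : ZMod n)) ⊆ T from fun x hx => by
        obtain ⟨i, hi, rfl⟩ := Finset.mem_image.1 hx
        exact hmem i (by have := Finset.mem_range.1 hi; omega))
    omega
  · exact Finset.card_image_le.trans (by rw [Finset.card_range, hT])

/-- Every vertex is reachable from the stable set `{0, 2, …, 2 * (k - 1)}`. -/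
theorem CyclicStable.exists_reachable {n k : ℕ} (hk : 0 < k) (hn : 2 * k < n) (hn2 : 2 ≤ n)
    (T : Finset (ZMod n)) (hT : CyclicStable T ∧ T.card = k) :
    ∃ hK : CyclicStable ((Finset.range k).image fun i : ℕ => 2 * (i : ZMod n)) ∧
        ((Finset.range k).image fun i : ℕ => 2 * (i : ZMod n)).card = k,
      (schrijverGraph n k).Reachable (toVertex hn2 hT) (toVertex hn2 hK) := by
  have : NeZero n := ⟨by omega⟩
  induction hm : ∑ x ∈ T, x.val using Nat.strong_induction_on generalizing T with
  | _ m ih =>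
  by_cases hfix : ∀ a ∈ T, a ≠ 0 → a - 2 ∈ T
  · have := Finset.eq_image_two_mul hn hT.2 hfix
    subst this
    exact ⟨hT, .rfl⟩
  push Not at hfix
  obtain ⟨a, ha, ha0, ha2⟩ := hfix
  have ha1 : a - 1 ∉ T := fun h => hT.1 _ h (by rwa [sub_add_cancel])
  have ha1' : a - 1 ∉ T.erase a := fun h => ha1 (Finset.mem_of_mem_erase h)
  have hstable : CyclicStable (insert (a - 1) (T.erase a)) := by
    intro x hx hx'
    simp only [Finset.mem_insert, Finset.mem_erase] at hx hx'
    rcases hx with rfl | ⟨hxa, hx⟩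
    · rw [sub_add_cancel] at hx'
      rcases hx' with h | h
      · exact ha1 (h ▸ ha)
      · exact h.1 rfl
    · rcases hx' with h | h
      · exact ha2 (by convert hx using 1; linear_combination -h)
      · exact hT.1 x hx h.2
  have hcard : (insert (a - 1) (T.erase a)).card = k := by
    rw [Finset.card_insert_of_notMem ha1', Finset.card_erase_add_one ha, hT.2]
  have hlt : ∑ x ∈ insert (a - 1) (T.erase a), x.val < m := by
    rw [Finset.sum_insert ha1', ← hm, ← Finset.add_sum_erase T (fun x => x.val) ha]
    have h1 := ZMod.val_add_one_eq_ite hn2 (a - 1)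
    rw [sub_add_cancel] at h1
    have h0 : a.val ≠ 0 := fun h => ha0 ((ZMod.val_eq_zero a).1 h)
    split_ifs at h1 <;> omega
  obtain ⟨hK, hreach⟩ := ih _ hlt _ ⟨hstable, hcard⟩ rfl
  refine ⟨hK, ?_⟩
  obtain ⟨C, hC, hCk, h1, h2⟩ := hstable.exists_common_neighbor hT.1 (by
    intro x hx hx1 hx2
    rcases Finset.mem_insert.1 hx1 with h | h
    · exact ha2 (by convert hx using 1; linear_combination -h)
    · exact hT.1 x hx (Finset.mem_of_mem_erase h))
  have hC' : CyclicStable C ∧ C.card = k := ⟨hC, hCk.trans hT.2⟩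
  exact ((adj_toVertex hn2 hk hC' hT h2).symm.reachable.trans
    (adj_toVertex hn2 hk ⟨hstable, hcard⟩ hC' h1).symm.reachable).trans hreach

theorem schrijverGraph_preconnected {n k : ℕ} (hk : 0 < k) (hn : 2 * k < n) :
    (schrijverGraph n k).Preconnected := by
  have hn2 : 2 ≤ n := by omega
  intro u v
  obtain ⟨A, hA, rfl⟩ := u.exists_toVertex_eq hn2
  obtain ⟨B, hB, rfl⟩ := v.exists_toVertex_eq hn2
  obtain ⟨hK, h1⟩ := CyclicStable.exists_reachable hk hn hn2 A hA
  obtain ⟨_, h2⟩ := CyclicStable.exists_reachable hk hn hn2 B hB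
  exact h1.trans h2.symm

/-- Finiteness keeps the extended diameter of the connected graph finite, so `diam` bounds distances
instead of taking its default value 0. -/
instance SchrijverVertex.instFinite (n k : ℕ) : Finite (SchrijverVertex n k) :=
  Finite.of_injective
    (fun v : SchrijverVertex n k => (⟨v.1, Finset.mem_powerset.2 v.2.1.1⟩ :
      (Finset.Icc 1 n).powerset))
    fun _ _ h => Subtype.ext (congrArg (fun s => s.1) h)

/-! ### The two witnesses -/

theorem mem_witnessA {k r x : ℕ} : x ∈ witnessA k r ↔ x = 1 ∨ x = 3 ∨ x = 5 ∨
    (∃ i ≤ k - 3 - r, x = 7 + 2 * i) ∨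
    ∃ j, 1 ≤ j ∧ j ≤ r - 1 ∧ x = 7 + 2 * (k - 3 - r) + 3 * j := by
  simp only [witnessA, Finset.mem_union, Finset.mem_insert, Finset.mem_singleton, Finset.mem_image,
    Finset.mem_Icc, zero_le, true_and, eq_comm (b := x), or_assoc, and_assoc]

theorem mem_witnessB {k r x : ℕ} : x ∈ witnessB k r ↔ x = 1 ∨ x = 3 ∨ x = 6 ∨
    (∃ i ≤ k - 3 - r, x = 8 + 2 * i) ∨
    ∃ j, 1 ≤ j ∧ j ≤ r - 1 ∧ x = 8 + 2 * (k - 3 - r) + 3 * j := by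
  simp only [witnessB, Finset.mem_union, Finset.mem_insert, Finset.mem_singleton, Finset.mem_image,
    Finset.mem_Icc, zero_le, true_and, eq_comm (b := x), or_assoc, and_assoc]

theorem witnessA_spec {n k r : ℕ} (hn : n = 2 * k + r) (hr : 2 ≤ r) (hk : r + 3 ≤ k) :
    IsTwoStable n (witnessA k r) ∧ (witnessA k r).card = k := by
  refine ⟨⟨fun x hx => ?_, fun x hx y hy hxy => ?_⟩, ?_⟩
  · rw [mem_witnessA] at hx
    rw [Finset.mem_Icc]
    rcases hx with rfl | rfl | rfl | ⟨i, hi, rfl⟩ | ⟨j, hj, hj', rfl⟩ <;> omega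
  · rw [mem_witnessA] at hx hy
    rcases hx with rfl | rfl | rfl | ⟨i, hi, rfl⟩ | ⟨j, hj, hj', rfl⟩ <;>
      rcases hy with rfl | rfl | rfl | ⟨i', hi', rfl⟩ | ⟨l, hl, hl', rfl⟩ <;> omega
  · rw [witnessA, Finset.card_union_of_disjoint, Finset.card_union_of_disjoint,
      Finset.card_image_of_injective, Finset.card_image_of_injective, Nat.card_Icc, Nat.card_Icc]
    · have : ({1, 3, 5} : Finset ℕ).card = 3 := rfl
      omega
    · intro i j hij
      simp only at hij
      omega
    · intro i j hij
      simp only at hij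
      omega
    · simp only [Finset.disjoint_right, Finset.mem_image, Finset.mem_Icc, Finset.mem_insert,
        Finset.mem_singleton]
      rintro _ ⟨i, hi, rfl⟩
      omega
    · simp only [Finset.disjoint_right, Finset.mem_image, Finset.mem_Icc, Finset.mem_insert,
        Finset.mem_singleton, Finset.mem_union]
      rintro _ ⟨i, hi, rfl⟩ (h | ⟨j, hj, h⟩) <;> omega

theorem witnessB_spec {n k r : ℕ} (hn : n = 2 * k + r) (hr : 2 ≤ r) (hk : r + 3 ≤ k) :
    IsTwoStable n (witnessB k r) ∧ (witnessB k r).card = k := by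
  refine ⟨⟨fun x hx => ?_, fun x hx y hy hxy => ?_⟩, ?_⟩
  · rw [mem_witnessB] at hx
    rw [Finset.mem_Icc]
    rcases hx with rfl | rfl | rfl | ⟨i, hi, rfl⟩ | ⟨j, hj, hj', rfl⟩ <;> omega
  · rw [mem_witnessB] at hx hy
    rcases hx with rfl | rfl | rfl | ⟨i, hi, rfl⟩ | ⟨j, hj, hj', rfl⟩ <;>
      rcases hy with rfl | rfl | rfl | ⟨i', hi', rfl⟩ | ⟨l, hl, hl', rfl⟩ <;> omega
  · rw [witnessB, Finset.card_union_of_disjoint, Finset.card_union_of_disjoint,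
      Finset.card_image_of_injective, Finset.card_image_of_injective, Nat.card_Icc, Nat.card_Icc]
    · have : ({1, 3, 6} : Finset ℕ).card = 3 := rfl
      omega
    · intro i j hij
      simp only at hij
      omega
    · intro i j hij
      simp only at hij
      omega
    · simp only [Finset.disjoint_right, Finset.mem_image, Finset.mem_Icc, Finset.mem_insert,
        Finset.mem_singleton]
      rintro _ ⟨i, hi, rfl⟩
      omega
    · simp only [Finset.disjoint_right, Finset.mem_image, Finset.mem_Icc, Finset.mem_insert,
        Finset.mem_singleton, Finset.mem_union]
      rintro _ ⟨i, hi, rfl⟩ (h | ⟨j, hj, h⟩) <;> omega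

theorem witnessA_gap {k r x : ℕ} (hr : 2 ≤ r) (hk : r + 3 ≤ k) (hx : 3 ≤ x)
    (hxn : x ≤ 2 * k + r) :
    x ∈ witnessA k r ∨ x - 1 ∈ witnessA k r ∨ x - 2 ∈ witnessA k r := by
  have hdouble : ∀ i ≤ k - 3 - r, 7 + 2 * i ∈ witnessA k r := fun i hi =>
    mem_witnessA.2 (Or.inr (Or.inr (Or.inr (Or.inl ⟨i, hi, rfl⟩))))
  -- Index 0 is allowed: it is the last term of the progression of step 2, where the step-3
  -- progression takes over.
  have htriple : ∀ j ≤ r - 1, 7 + 2 * (k - 3 - r) + 3 * j ∈ witnessA k r := fun j hj => by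
    rcases Nat.eq_zero_or_pos j with rfl | hj0
    · exact hdouble _ le_rfl
    · exact mem_witnessA.2 (Or.inr (Or.inr (Or.inr (Or.inr ⟨j, hj0, hj, rfl⟩))))
  by_cases h7 : x < 7
  · simp only [mem_witnessA]
    omega
  by_cases ht : x < 7 + 2 * (k - 3 - r)
  · have := hdouble ((x - 7) / 2) (by omega)
    rcases Nat.mod_two_eq_zero_or_one (x - 7) with h | h
    · exact Or.inl (by convert this using 1; omega)
    · exact Or.inr (Or.inl (by convert this using 1; omega))
  · have := htriple ((x - (7 + 2 * (k - 3 - r))) / 3) (by omega)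
    have hmod := Nat.mod_lt (x - (7 + 2 * (k - 3 - r))) (show 0 < 3 by norm_num)
    interval_cases hm : (x - (7 + 2 * (k - 3 - r))) % 3
    · exact Or.inl (by convert this using 1; omega)
    · exact Or.inr (Or.inl (by convert this using 1; omega))
    · exact Or.inr (Or.inr (by convert this using 1; omega))

theorem witnessB_gap {k r x : ℕ} (hr : 2 ≤ r) (hk : r + 3 ≤ k) (hx : 3 ≤ x)
    (hxn : x ≤ 2 * k + r) :
    x ∈ witnessB k r ∨ x - 1 ∈ witnessB k r ∨ x - 2 ∈ witnessB k r := by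
  have hdouble : ∀ i ≤ k - 3 - r, 8 + 2 * i ∈ witnessB k r := fun i hi =>
    mem_witnessB.2 (Or.inr (Or.inr (Or.inr (Or.inl ⟨i, hi, rfl⟩))))
  have htriple : ∀ j ≤ r - 1, 8 + 2 * (k - 3 - r) + 3 * j ∈ witnessB k r := fun j hj => by
    rcases Nat.eq_zero_or_pos j with rfl | hj0
    · exact hdouble _ le_rfl
    · exact mem_witnessB.2 (Or.inr (Or.inr (Or.inr (Or.inr ⟨j, hj0, hj, rfl⟩))))
  by_cases h7 : x < 8
  · simp only [mem_witnessB]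
    omega
  by_cases ht : x < 8 + 2 * (k - 3 - r)
  · have := hdouble ((x - 8) / 2) (by omega)
    rcases Nat.mod_two_eq_zero_or_one (x - 8) with h | h
    · exact Or.inl (by convert this using 1; omega)
    · exact Or.inr (Or.inl (by convert this using 1; omega))
  · have := htriple ((x - (8 + 2 * (k - 3 - r))) / 3) (by omega)
    have hmod := Nat.mod_lt (x - (8 + 2 * (k - 3 - r))) (show 0 < 3 by norm_num)
    interval_cases hm : (x - (8 + 2 * (k - 3 - r))) % 3
    · exact Or.inl (by convert this using 1; omega)
    · exact Or.inr (Or.inl (by convert this using 1; omega))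
    · exact Or.inr (Or.inr (by convert this using 1; omega))

/-! ### Forced midpoints and the lower bound -/

/-- If `1 ∈ S` and all gaps of `S` have length at most three, then a stable set of the size of `S`
which is disjoint from `S` contains each point between two elements of `S`. -/
theorem IsTwoStable.mem_of_disjoint {n : ℕ} {S T : Finset ℕ} (hT : IsTwoStable n T)
    (hcard : T.card = S.card) (hST : Disjoint S T) (h1 : 1 ∈ S)
    (hgap : ∀ x, 3 ≤ x → x ≤ n → x ∈ S ∨ x - 1 ∈ S ∨ x - 2 ∈ S) {a : ℕ} (ha : a ∈ S)
    (ha2 : a + 2 ∈ S) : a + 1 ∈ T := by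
  have hdisj : ∀ x ∈ T, x ∉ S := fun x hx hxS => Finset.disjoint_left.1 hST hxS hx
  -- Each element of `T` goes to its predecessor in `S`. As `1 ∈ S`, nothing wraps around. Two
  -- elements with the same predecessor would be consecutive, so equal cardinalities make the map
  -- onto.
  have hmaps : Set.MapsTo (fun x => if x - 1 ∈ S then x - 1 else x - 2) (T : Set ℕ) S := by
    intro x hx
    have hx' : x ∈ T := hx
    have hxn := Finset.mem_Icc.1 (hT.1 hx')
    show (if x - 1 ∈ S then x - 1 else x - 2) ∈ S
    split_ifs with h
    · exact h
    · rcases Nat.lt_or_ge x 3 with hx3 | hx3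
      · have : x = 1 ∨ x = 2 := by omega
        rcases this with rfl | rfl
        · exact absurd h1 (hdisj _ hx')
        · exact absurd h1 h
      · rcases hgap x hx3 hxn.2 with h' | h' | h'
        · exact absurd h' (hdisj _ hx')
        · exact absurd h' h
        · exact h'
  have hinj : Set.InjOn (fun x => if x - 1 ∈ S then x - 1 else x - 2) (T : Set ℕ) := by
    intro x hx y hy hxy
    have hxT : x ∈ T := hx
    have hyT : y ∈ T := hy
    have hx1 := Finset.mem_Icc.1 (hT.1 hxT)
    have hy1 := Finset.mem_Icc.1 (hT.1 hyT)
    have hx1' : x ≠ 1 := fun h => hdisj x hxT (h ▸ h1)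
    have hy1' : y ≠ 1 := fun h => hdisj y hyT (h ▸ h1)
    replace hxy : (if x - 1 ∈ S then x - 1 else x - 2) = if y - 1 ∈ S then y - 1 else y - 2 := hxy
    rcases lt_trichotomy x y with h | h | h
    · have := (hT.2 x hxT y hyT h).1
      split_ifs at hxy <;> omega
    · exact h
    · have := (hT.2 y hyT x hxT h).1
      split_ifs at hxy <;> omega
  obtain ⟨x, hx, hxa⟩ := Finset.surjOn_of_injOn_of_card_le _ hmaps hinj hcard.ge ha
  have hxT : x ∈ T := hx
  have hx1 := Finset.mem_Icc.1 (hT.1 hxT)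
  have hx1' : x ≠ 1 := fun h => hdisj x hxT (h ▸ h1)
  replace hxa : (if x - 1 ∈ S then x - 1 else x - 2) = a := hxa
  split_ifs at hxa
  · rwa [show a + 1 = x by omega]
  · exact absurd ha2 (by rw [show a + 2 = x by omega]; exact hdisj x hxT)

theorem four_le_length_of_walk {n k r : ℕ} (hn : n = 2 * k + r) (hr : 2 ≤ r) (hk : r + 3 ≤ k)
    {u v : SchrijverVertex n k} (hu : u.1 = witnessA k r) (hv : v.1 = witnessB k r)
    (p : (schrijverGraph n k).Walk u v) : 4 ≤ p.length := by
  subst hn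
  have hA1 : 1 ∈ u.1 := by rw [hu, mem_witnessA]; simp
  have hA3 : 3 ∈ u.1 := by rw [hu, mem_witnessA]; simp
  have hA5 : 5 ∈ u.1 := by rw [hu, mem_witnessA]; simp
  have hA7 : 7 ∈ u.1 := by
    rw [hu, mem_witnessA]
    exact Or.inr (Or.inr (Or.inr (Or.inl ⟨0, Nat.zero_le _, rfl⟩)))
  have hB1 : 1 ∈ v.1 := by rw [hv, mem_witnessB]; simp
  have hB3 : 3 ∈ v.1 := by rw [hv, mem_witnessB]; simp
  have hB6 : 6 ∈ v.1 := by rw [hv, mem_witnessB]; simp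
  have hB5 : 5 ∉ v.1 := by
    rw [hv, mem_witnessB]
    rintro (h | h | h | ⟨i, -, h⟩ | ⟨j, -, -, h⟩) <;> omega
  have hforceA : ∀ c : SchrijverVertex (2 * k + r) k, (schrijverGraph _ k).Adj u c →
      ∀ a, a ∈ u.1 → a + 2 ∈ u.1 → a + 1 ∈ c.1 := fun c hc a ha ha2 =>
    c.2.1.mem_of_disjoint (c.2.2.trans u.2.2.symm) hc.2 hA1
      (fun x hx hxn => hu ▸ witnessA_gap hr hk hx hxn) ha ha2
  have hforceB : ∀ c : SchrijverVertex (2 * k + r) k, (schrijverGraph _ k).Adj v c →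
      ∀ a, a ∈ v.1 → a + 2 ∈ v.1 → a + 1 ∈ c.1 := fun c hc a ha ha2 =>
    c.2.1.mem_of_disjoint (c.2.2.trans v.2.2.symm) hc.2 hB1
      (fun x hx hxn => hv ▸ witnessB_gap hr hk hx hxn) ha ha2
  match p with
  | .nil => exact absurd hA5 hB5
  | .cons h .nil => exact absurd hB1 (Finset.disjoint_left.1 h.2 hA1)
  | .cons h (.cons h' .nil) =>
    exact absurd hB6 (Finset.disjoint_left.1 h'.2 (hforceA _ h 5 hA5 hA7))
  | .cons h (.cons h' (.cons h'' .nil)) =>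
    exact absurd (hforceB _ h''.symm 1 hB1 hB3)
      (Finset.disjoint_left.1 h'.2 (hforceA _ h 1 hA1 hA3))
  | .cons _ (.cons _ (.cons _ (.cons _ q))) =>
    simp only [SimpleGraph.Walk.length_cons]
    omega

/-! ### Assembling the bounds -/

theorem mainTheorem4 :
    (∀ n k r : ℕ, n = 2 * k + r → 2 ≤ r → r + 3 ≤ k →
      (schrijverGraph n k).Connected ∧
      4 ≤ (schrijverGraph n k).diam ∧
      ∃ (hA : IsTwoStable n (witnessA k r) ∧ (witnessA k r).card = k)
        (hB : IsTwoStable n (witnessB k r) ∧ (witnessB k r).card = k),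
        4 ≤ (schrijverGraph n k).dist ⟨witnessA k r, hA⟩ ⟨witnessB k r, hB⟩) ∧
    (∀ k : ℕ, 5 ≤ k → (schrijverGraph (3 * k - 3) k).diam = 4) := by
  have main : ∀ n k r : ℕ, n = 2 * k + r → 2 ≤ r → r + 3 ≤ k →
      (schrijverGraph n k).Connected ∧
      4 ≤ (schrijverGraph n k).diam ∧
      ∃ (hA : IsTwoStable n (witnessA k r) ∧ (witnessA k r).card = k)
        (hB : IsTwoStable n (witnessB k r) ∧ (witnessB k r).card = k),
        4 ≤ (schrijverGraph n k).dist ⟨witnessA k r, hA⟩ ⟨witnessB k r, hB⟩ := by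
    intro n k r hn hr hk
    have hA := witnessA_spec hn hr hk
    have hB := witnessB_spec hn hr hk
    have : Nonempty (SchrijverVertex n k) := ⟨⟨_, hA⟩⟩
    have hconn : (schrijverGraph n k).Connected :=
      ⟨schrijverGraph_preconnected (by omega) (by omega)⟩
    have hdist : 4 ≤ (schrijverGraph n k).dist ⟨witnessA k r, hA⟩ ⟨witnessB k r, hB⟩ := by
      obtain ⟨p, hp⟩ := hconn.exists_walk_length_eq_dist ⟨witnessA k r, hA⟩ ⟨witnessB k r, hB⟩
      rw [← hp]
      exact four_le_length_of_walk hn hr hk rfl rfl p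
    exact ⟨hconn, hdist.trans (SimpleGraph.dist_le_diam
      (SimpleGraph.connected_iff_ediam_ne_top.1 hconn)), hA, hB, hdist⟩
  -- For `n = 3k - 3` the parameter is `r = k - 3`, so `t = 0`, and `k ≥ 5` gives `r ≥ 2`.
  refine ⟨main, fun k hk => le_antisymm ?_
    (main (3 * k - 3) k (k - 3) (by omega) (by omega) (by omega)).2.1⟩
  have hconn := (main (3 * k - 3) k (k - 3) (by omega) (by omega) (by omega)).1
  have := hconn.nonempty
  obtain ⟨u, v, huv⟩ := (schrijverGraph (3 * k - 3) k).exists_dist_eq_diam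
  obtain ⟨p, hp⟩ := exists_walk_length_le_four (by omega) u v
  exact huv ▸ (SimpleGraph.dist_le p).trans hp
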